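/- **Model.** Let $(x_1,y_1),\dots,(x_n,y_n)\in\mathbb{R}^d\times\mathbb{R}$ be i.i.d. copies of $(x,y)$, where $y=\langle\theta^*,x\rangle+\zeta$, $\mathbb{E}x=0$, $\mathbb{E}[\zeta\mid x]=0$, $\|\theta^*\|_0\le k$, and let $\Sigma$ be the covariance matrix of $x$. Assume: 1. $\|\theta^*\|_1\le 1$, and there are constants $\kappa_\infty,\kappa_x>0$ with $\|\Sigma w\|_\infty\ge\kappa_\infty\|w\|_\infty$ for all $w\in\mathbb{R}^d$ and $\|\Sigma^{-1/2}x\|_{\psi_2}\le\kappa_x$. Here $\|X\|_{\psi_2}=\inf\{c>0:\mathbb{E}\exp(X^2/c^2)\le 2\}$ for a random variable, and for a random vector $\|X\|_{\psi_2}=\sup_{\|u\|_2=1}\|\langle X,u\rangle\|_{\psi_2}$. 2. For a constant $\sigma>0$, $x$ is a zero-mean sub-Gaussian vector with variance $\sigma^2$ and $y$ is a zero-mean sub-Gaussian variable with variance $\sigma^2$, i.e. $\mathbb{E}e^{tX}\le e^{\sigma^2t^2/2}$ for all $t\in\mathbb{R}$, where $X=y$ or $X=\langle x,u\rangle$ with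 $\|u\|_2=1$. **Algorithm** (parameters $r,\tau_1,\tau_2,\lambda_n,\epsilon,\delta$). User $i$ computes $\bar x_i=x_i\min\{1,r/\|x_i\|_2\}$, $\tilde x_{ij}=\operatorname{sgn}(x_{ij})\min\{|x_{ij}|,\tau_1\}$ and $\tilde y_i=\operatorname{sgn}(y_i)\min\{|y_i|,\tau_2\}$, and releases $\bar x_i\bar x_i^T+n_{1,i}$ and $\tilde x_i\tilde y_i+n_{2,i}$. Here $n_{1,i}$ is a symmetric $d\times d$ matrix whose upper-triangular entries (diagonal included) are independent $\mathcal N\big(0,\tfrac{32r^4\log(2.5/\delta)}{\epsilon^2}\big)$, $n_{2,i}\sim\mathcal N\big(0,\tfrac{32d\tau_1^2\tau_2^2\log(2.5/\delta)}{\epsilon^2}I_d\big)$, and all the noises are independent of each other and of the data. The server averages the released matrices to $\dot\Sigma_{\bar X\bar X}$ and the released vectors to $\dot\Sigma_{\tilde X\tilde Y}$, and outputs $$\hat\theta^{priv}=S_{\lambda_n}\big(\dot\Sigma_{\bar X\bar X}^{-1}\dot\Sigma_{\tilde X\tilde Y}\big),\qquad [S_\lambda(u)]_j=\operatorname{sgn}(u_j)\max\{|u_j|-\lambda,0\}.$$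 **Theorem.** There are absolute constants $a_\tau,a_r,c,c'>0$ such that for all $\sigma,\kappa_\infty,\kappa_x>0$ and $\delta_0\in(0,1)$ there are constants $a_\lambda,C_1,C_2,C_3>0$, depending only on $\sigma,\kappa_\infty,\kappa_x,\delta_0$, for which the following holds. Let $d\ge1$, $n\ge2$, $k\ge 0$, $0<\epsilon<1$, $0<\delta\le\delta_0$, let the model satisfy the assumptions above, and run the algorithm with $$\tau_1=\tau_2=a_\tau\,\sigma\sqrt{\log n},\qquad r=a_r\,\sigma\sqrt{d\log n},\qquad \lambda_n=a_\lambda\,\frac{d\log n\sqrt{\log d\,\log\frac1\delta}}{\sqrt n\,\epsilon}.$$ If $$n\ \ge\ C_1\,\log^2 n\,\log d\,\log\tfrac1\delta\;\max\Big\{\frac{d^4}{\epsilon^2\kappa_\infty},\ \frac{\|\Sigma\|_2^4\,d^3}{\epsilon^2\lambda_{\min}^2(\Sigma)}\Big\},$$ then with probability at least $1-C_3d^{-c}-e^{-c'd}$ the matrix $\dot\Sigma_{\bar X\bar X}$ is invertible and $$\|\hat\theta^{priv}-\theta^*\|_2\ \le\ C_2\,\frac{d\log n\sqrt{k\log d\,\log\frac1\delta}}{\sqrt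 n\,\epsilon}.$$ -/

import Mathlib

open MeasureTheory ProbabilityTheory
open scoped NNReal ENNReal RealInnerProductSpace MatrixOrder

namespace SparseLDP

/-! ### Norms and matrix quantities -/

/-- The number of non-zero coordinates of a vector. -/
noncomputable def l0norm {d : ℕ} (θ : EuclideanSpace ℝ (Fin d)) : ℕ :=
  Set.ncard {j : Fin d | θ j ≠ 0}

/-- The `ℓ₁` norm. -/
def l1norm {d : ℕ} (θ : EuclideanSpace ℝ (Fin d)) : ℝ := ∑ j, |θ j|

/-- The spectral norm (operator norm for the Euclidean norm). -/
noncomputable def specNorm {d : ℕ} (A : Matrix (Fin d) (Fin d) ℝ) : ℝ :=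
  ‖Matrix.toEuclideanCLM (𝕜 := ℝ) A‖

/-- The smallest (real) eigenvalue, used for symmetric matrices of positive size. -/
noncomputable def lambdaMin {d : ℕ} (A : Matrix (Fin d) (Fin d) ℝ) : ℝ := sInf (spectrum ℝ A)

/-! ### Sub-Gaussian norms -/

/-- `‖X‖_{ψ₂} = inf {c > 0 : E exp(X² / c²) ≤ 2}`, with value `∞` if there is no such `c`. -/
noncomputable def psi2Norm {Ω : Type*} [MeasurableSpace Ω] (X : Ω → ℝ) (μ : Measure Ω) : ℝ≥0∞ :=
  sInf {a : ℝ≥0∞ | ∃ c : ℝ, 0 < c ∧ a = ENNReal.ofReal c ∧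
    ∫⁻ ω, ENNReal.ofReal (Real.exp (X ω ^ 2 / c ^ 2)) ∂μ ≤ 2}

/-- The `ψ₂` norm of a random vector: the supremum of the norms of its one-dimensional marginals. -/
noncomputable def psi2NormVec {Ω : Type*} [MeasurableSpace Ω] {d : ℕ}
    (X : Ω → EuclideanSpace ℝ (Fin d)) (μ : Measure Ω) : ℝ≥0∞ :=
  ⨆ u : {u : EuclideanSpace ℝ (Fin d) // ‖u‖ = 1}, psi2Norm (fun ω => ⟪X ω, (u : _)⟫) μ

/-! ### The statistical model: `P` is the joint law of one sample `(x, y)` -/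

/-- The covariance matrix of `x`. -/
noncomputable def covMat {d : ℕ} (P : Measure (EuclideanSpace ℝ (Fin d) × ℝ)) :
    Matrix (Fin d) (Fin d) ℝ :=
  Matrix.of fun i j => cov[fun z => z.1 i, fun z => z.1 j; P]

/-- The sparse linear model `y = ⟨θ, x⟩ + ζ`, where `E x = 0`, `E[ζ | x] = 0` and `‖θ‖₀ ≤ k`;
the noise is `ζ = y - ⟨θ, x⟩`. -/
structure IsSparseLinearModel {d : ℕ} (P : Measure (EuclideanSpace ℝ (Fin d) × ℝ))
    (θ : EuclideanSpace ℝ (Fin d)) (k : ℕ) : Prop where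
  sparse : l0norm θ ≤ k
  integrable_x : Integrable (fun z => z.1) P
  mean_x : ∫ z, z.1 ∂P = 0
  integrable_noise : Integrable (fun z => z.2 - ⟪θ, z.1⟫) P
  condExp_noise :
    P[fun z : EuclideanSpace ℝ (Fin d) × ℝ => z.2 - ⟪θ, z.1⟫ |
      MeasurableSpace.comap Prod.fst inferInstance] =ᵐ[P] 0

/-- The covariance / `ℓ₁` assumption: `‖θ‖₁ ≤ 1`, `‖Σ w‖_∞ ≥ κ_∞ ‖w‖_∞` for all `w` (the norm on
`Fin d → ℝ` is the sup norm), and `‖Σ^{-1/2} x‖_{ψ₂} ≤ κ_x`. -/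
structure CovarianceAssumption {d : ℕ} (P : Measure (EuclideanSpace ℝ (Fin d) × ℝ))
    (θ : EuclideanSpace ℝ (Fin d)) (κinf κx : ℝ) : Prop where
  l1_le_one : l1norm θ ≤ 1
  lower_inf : ∀ w : Fin d → ℝ, κinf * ‖w‖ ≤ ‖Matrix.mulVec (covMat P) w‖
  psi2_le : psi2NormVec
    (fun z : EuclideanSpace ℝ (Fin d) × ℝ =>
      Matrix.toEuclideanCLM (𝕜 := ℝ) (CFC.sqrt (covMat P))⁻¹ z.1) P ≤ ENNReal.ofReal κx

/-- `x` is a zero-mean sub-Gaussian vector and `y` a zero-mean sub-Gaussian variable, both with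
variance parameter `σ²`. -/
structure SubGaussianAssumption {d : ℕ} (P : Measure (EuclideanSpace ℝ (Fin d) × ℝ))
    (σ : ℝ≥0) : Prop where
  mean_x : ∫ z, z.1 ∂P = 0
  subG_x : ∀ u : EuclideanSpace ℝ (Fin d), ‖u‖ = 1 →
    HasSubgaussianMGF (fun z => ⟪z.1, u⟫) (σ ^ 2) P
  mean_y : ∫ z, z.2 ∂P = 0
  subG_y : HasSubgaussianMGF (fun z => z.2) (σ ^ 2) P

/-! ### The algorithm -/

/-- `ℓ₂` clipping `x ↦ x · min {1, r / ‖x‖₂}`. -/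
noncomputable def clipL2 {d : ℕ} (r : ℝ) (x : EuclideanSpace ℝ (Fin d)) :
    EuclideanSpace ℝ (Fin d) :=
  min 1 (r / ‖x‖) • x

/-- Scalar shrinkage `t ↦ sgn(t) min {|t|, τ}`. -/
noncomputable def shrink (τ t : ℝ) : ℝ := Real.sign t * min |t| τ

/-- Element-wise soft thresholding. -/
noncomputable def softThreshold {d : ℕ} (lam : ℝ) (u : Fin d → ℝ) : EuclideanSpace ℝ (Fin d) :=
  WithLp.toLp 2 fun j => Real.sign (u j) * max (|u j| - lam) 0

/-- The symmetric matrix with the same upper triangle (diagonal included) as `G`. -/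
def symmOfUpper {d : ℕ} (G : Fin d → Fin d → ℝ) : Matrix (Fin d) (Fin d) ℝ :=
  Matrix.of fun i j => G (min i j) (max i j)

/-- The randomness of one user: a matrix, of which only the upper triangle is used, and a vector. -/
abbrev Noise (d : ℕ) : Type := (Fin d → Fin d → ℝ) × (Fin d → ℝ)

/-- The law of the randomness of one user: the entries are independent centred Gaussians, with
variance `32 r⁴ log(2.5/δ) / ε²` in the matrix and `32 d τ₁² τ₂² log(2.5/δ) / ε²` in the vector. -/
noncomputable def noiseLaw (d : ℕ) (r τ₁ τ₂ ε δ : ℝ) : Measure (Noise d) :=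
  (Measure.pi fun _ : Fin d => Measure.pi fun _ : Fin d =>
      gaussianReal 0 (Real.toNNReal (32 * r ^ 4 * Real.log (2.5 / δ) / ε ^ 2))).prod
    (Measure.pi fun _ : Fin d =>
      gaussianReal 0 (Real.toNNReal (32 * d * τ₁ ^ 2 * τ₂ ^ 2 * Real.log (2.5 / δ) / ε ^ 2)))

/-- What one user, holding `(x, y)` and randomness `N`, releases: the noisy clipped second-moment
matrix `x̄ x̄ᵀ + n₁` and the noisy shrunken vector `x̃ ỹ + n₂`. -/
noncomputable def localReport {d : ℕ} (r τ₁ τ₂ : ℝ) (z : EuclideanSpace ℝ (Fin d) × ℝ)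
    (N : Noise d) : Matrix (Fin d) (Fin d) ℝ × (Fin d → ℝ) :=
  (Matrix.vecMulVec (clipL2 r z.1).ofLp (clipL2 r z.1).ofLp + symmOfUpper N.1,
    fun j => shrink τ₁ (z.1 j) * shrink τ₂ z.2 + N.2 j)

/-- The server's average of the released matrices. -/
noncomputable def serverCov {d n : ℕ}
    (R : Fin n → Matrix (Fin d) (Fin d) ℝ × (Fin d → ℝ)) : Matrix (Fin d) (Fin d) ℝ :=
  (n : ℝ)⁻¹ • ∑ i, (R i).1

/-- The server's average of the released vectors. -/
noncomputable def serverCross {d n : ℕ}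
    (R : Fin n → Matrix (Fin d) (Fin d) ℝ × (Fin d → ℝ)) : Fin d → ℝ :=
  (n : ℝ)⁻¹ • ∑ i, (R i).2

/-- The server's output, computed from the users' reports. -/
noncomputable def serverEstimate {d n : ℕ} (lam : ℝ)
    (R : Fin n → Matrix (Fin d) (Fin d) ℝ × (Fin d → ℝ)) : EuclideanSpace ℝ (Fin d) :=
  softThreshold lam (Matrix.mulVec (serverCov R)⁻¹ (serverCross R))

/-- The joint law of `n` i.i.d. samples from `P` and of the users' independent randomness. -/
noncomputable def experiment {d : ℕ} (n : ℕ) (P : Measure (EuclideanSpace ℝ (Fin d) × ℝ))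
    (r τ₁ τ₂ ε δ : ℝ) :
    Measure ((Fin n → EuclideanSpace ℝ (Fin d) × ℝ) × (Fin n → Noise d)) :=
  (Measure.pi fun _ : Fin n => P).prod (Measure.pi fun _ : Fin n => noiseLaw d r τ₁ τ₂ ε δ)

/-- All reports sent to the server. -/
noncomputable def reports {d n : ℕ} (r τ₁ τ₂ : ℝ)
    (ω : (Fin n → EuclideanSpace ℝ (Fin d) × ℝ) × (Fin n → Noise d)) :
    Fin n → Matrix (Fin d) (Fin d) ℝ × (Fin d → ℝ) :=
  fun i => localReport r τ₁ τ₂ (ω.1 i) (ω.2 i)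

end SparseLDP

namespace SparseLDP

/-! ### Deterministic part -/

/-! With thresholds `2σ√(log n)` every coordinate of every sample, and every `y`, stays unclipped
except with probability of order `d / n`. Off this event no truncation bias has to be analysed: the
server's matrix `A` is the sample second moment plus averaged Gaussian noise, and `b - A θ`, with
`b` the server's vector, is the average of `x ζ` plus averaged noise.

The argument lives in the sup norm. If every row of `A - Σ` has absolute sum at most `κ / 2`, then
`A` inherits from `Σ` the bound `‖A w‖ ≥ (κ / 2) ‖w‖`. So `A` is invertible, and `A⁻¹ b` is within
`lam` of `θ` as soon as each entry of `b - A θ` is at most `(κ / 2) lam`. Soft thresholding then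
kills the coordinates off the support of `θ` and costs at most `2 lam` on it, whence `2 lam √k`.
`estimate_of_no_clipping` is this deterministic half.

For the random half, a failure probability of order `1 / d` is enough, so Chebyshev with fourth
moments handles the sample averages, while sub-Gaussian tails and a union bound handle the noise.
`estimate_of_rate` collects the four bad events in terms of the rate `s = d log n √(log d log(1/δ))
/ (√n ε)`. The `d⁴` sample size makes `d` noise entries of size proportional to `s` fit into `κ /
4`. -/

lemma abs_softThreshold_sub_le {lam u t : ℝ} (h : |u - t| ≤ lam) :
    |Real.sign u * max (|u| - lam) 0 - t| ≤ 2 * lam := by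
  have h' := abs_le.1 h
  rcases lt_trichotomy u 0 with hu | hu | hu
  · rw [Real.sign_of_neg hu, abs_of_neg hu]
    rcases max_cases (-u - lam) 0 with ⟨e, _⟩ | ⟨e, _⟩ <;> rw [e, abs_le] <;>
      constructor <;> linarith
  · subst hu
    simp only [Real.sign_zero, zero_mul, abs_le]
    constructor <;> linarith
  · rw [Real.sign_of_pos hu, abs_of_pos hu]
    rcases max_cases (u - lam) 0 with ⟨e, _⟩ | ⟨e, _⟩ <;> rw [e, abs_le] <;>
      constructor <;> linarith

/-- Soft thresholding a sup-norm approximation of a sparse vector gives an `ℓ₂` approximation. -/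
lemma norm_softThreshold_sub_le {d k : ℕ} {lam : ℝ} {u : Fin d → ℝ}
    {θ : EuclideanSpace ℝ (Fin d)} (hlam : 0 ≤ lam) (h : ∀ j, |u j - θ j| ≤ lam)
    (hk : l0norm θ ≤ k) : ‖softThreshold lam u - θ‖ ≤ 2 * lam * √k := by
  classical
  rw [EuclideanSpace.norm_eq]
  refine Real.sqrt_le_iff.2 ⟨by positivity, ?_⟩
  calc ∑ j, ‖(softThreshold lam u - θ) j‖ ^ 2
      ≤ ∑ j, if θ j ≠ 0 then (2 * lam) ^ 2 else 0 := by
        refine Finset.sum_le_sum fun j _ => ?_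
        have e : (softThreshold lam u - θ) j
            = Real.sign (u j) * max (|u j| - lam) 0 - θ j := rfl
        rw [e, Real.norm_eq_abs]
        split_ifs with hj
        · exact pow_le_pow_left₀ (abs_nonneg _) (abs_softThreshold_sub_le (h j)) 2
        -- Off the support `|u j| ≤ lam`, so thresholding returns exactly zero.
        · have hj' : θ j = 0 := not_not.1 hj
          have := h j
          rw [hj', sub_zero] at this
          rw [hj', max_eq_right (by linarith)]
          simp
    _ = (l0norm θ : ℝ) * (2 * lam) ^ 2 := by
        rw [← Finset.sum_filter, Finset.sum_const, nsmul_eq_mul, l0norm,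
          Set.ncard_eq_toFinset_card', Set.toFinset_ofPred]
    _ ≤ k * (2 * lam) ^ 2 := by gcongr
    _ = (2 * lam * √k) ^ 2 := by rw [mul_pow _ (√k), Real.sq_sqrt (Nat.cast_nonneg k)]; ring

/-! ### Linear systems bounded below in the sup norm -/

lemma norm_mulVec_le_of_row_sum_le {d : ℕ} {B : Matrix (Fin d) (Fin d) ℝ} {η : ℝ} (hη : 0 ≤ η)
    (hB : ∀ j, ∑ k, |B j k| ≤ η) (w : Fin d → ℝ) : ‖B.mulVec w‖ ≤ η * ‖w‖ := by
  refine (pi_norm_le_iff_of_nonneg (by positivity)).2 fun j => ?_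
  calc ‖B.mulVec w j‖ ≤ ∑ k, ‖B j k * w k‖ := by
        rw [Matrix.mulVec, dotProduct]; exact norm_sum_le _ _
    _ ≤ ∑ k, |B j k| * ‖w‖ := by
        refine Finset.sum_le_sum fun k _ => ?_
        rw [norm_mul, Real.norm_eq_abs]
        gcongr
        exact norm_le_pi_norm w k
    _ = (∑ k, |B j k|) * ‖w‖ := by rw [Finset.sum_mul]
    _ ≤ η * ‖w‖ := by gcongr; exact hB j

/-- Cauchy–Schwarz on one row, whose square sum is at most that of the whole matrix. The squared
Frobenius error has a computable expectation, so it is the quantity to feed to Chebyshev. -/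
lemma row_sum_abs_le_of_sum_sq_le {d : ℕ} {B : Matrix (Fin d) (Fin d) ℝ} {η : ℝ} (hη : 0 ≤ η)
    (hB : d * ∑ p : Fin d × Fin d, B p.1 p.2 ^ 2 ≤ η ^ 2) (j : Fin d) : ∑ k, |B j k| ≤ η := by
  refine abs_le_of_sq_le_sq' ?_ hη |>.2
  calc (∑ k, |B j k|) ^ 2 ≤ d * ∑ k, |B j k| ^ 2 := by
        simpa using sq_sum_le_card_mul_sum_sq (s := Finset.univ) (f := fun k => |B j k|)
    _ = d * ∑ k, B j k ^ 2 := by simp only [sq_abs]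
    _ ≤ d * ∑ i, ∑ k, B i k ^ 2 := by
        refine mul_le_mul_of_nonneg_left ?_ (Nat.cast_nonneg d)
        exact Finset.single_le_sum (f := fun i => ∑ k, B i k ^ 2)
          (fun i _ => Finset.sum_nonneg fun k _ => sq_nonneg _) (Finset.mem_univ j)
    _ ≤ η ^ 2 := by rwa [← Fintype.sum_prod_type']

lemma le_norm_add_mulVec {d : ℕ} {S B : Matrix (Fin d) (Fin d) ℝ} {κ η : ℝ}
    (hS : ∀ w : Fin d → ℝ, κ * ‖w‖ ≤ ‖S.mulVec w‖)
    (hB : ∀ w : Fin d → ℝ, ‖B.mulVec w‖ ≤ η * ‖w‖) (w : Fin d → ℝ) :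
    (κ - η) * ‖w‖ ≤ ‖(S + B).mulVec w‖ := by
  have h1 : ‖S.mulVec w‖ ≤ ‖(S + B).mulVec w‖ + ‖B.mulVec w‖ := by
    have := norm_sub_le ((S + B).mulVec w) (B.mulVec w)
    rwa [← Matrix.sub_mulVec, add_sub_cancel_right] at this
  linarith [hS w, hB w]

lemma isUnit_det_of_le_norm_mulVec {d : ℕ} {A : Matrix (Fin d) (Fin d) ℝ} {κ : ℝ} (hκ : 0 < κ)
    (hA : ∀ w : Fin d → ℝ, κ * ‖w‖ ≤ ‖A.mulVec w‖) : IsUnit A.det := by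
  rw [← Matrix.isUnit_iff_isUnit_det, ← Matrix.mulVec_injective_iff_isUnit]
  intro v w hvw
  have h := hA (v - w)
  have hvw' : A.mulVec v = A.mulVec w := hvw
  rw [Matrix.mulVec_sub, hvw', sub_self, norm_zero] at h
  have : ‖v - w‖ = 0 := le_antisymm (by nlinarith [norm_nonneg (v - w)]) (norm_nonneg _)
  exact sub_eq_zero.1 (norm_eq_zero.1 this)

/-- The lower bound on `A` is applied to the error `A⁻¹ b - t`, which `A` sends to the residual `b -
A t`; no norm of `A⁻¹` has to be estimated. -/
lemma abs_inv_mulVec_sub_le {d : ℕ} {A : Matrix (Fin d) (Fin d) ℝ} {b t : Fin d → ℝ} {κ lam : ℝ}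
    (hκ : 0 < κ) (hA : ∀ w : Fin d → ℝ, κ * ‖w‖ ≤ ‖A.mulVec w‖)
    (hlam : 0 ≤ lam) (hb : ∀ j, |b j - A.mulVec t j| ≤ κ * lam) (j : Fin d) :
    |A⁻¹.mulVec b j - t j| ≤ lam := by
  have hu := isUnit_det_of_le_norm_mulVec hκ hA
  have h := hA (A⁻¹.mulVec b - t)
  rw [Matrix.mulVec_sub, Matrix.mulVec_mulVec, Matrix.mul_nonsing_inv _ hu,
    Matrix.one_mulVec] at h
  have h2 : ‖b - A.mulVec t‖ ≤ κ * lam := by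
    refine (pi_norm_le_iff_of_nonneg (by positivity)).2 fun j => ?_
    simpa using hb j
  have h3 : ‖A⁻¹.mulVec b - t‖ ≤ lam := le_of_mul_le_mul_left (h.trans h2) hκ
  simpa using (norm_le_pi_norm _ j).trans h3

/-! ### Inactive clipping and elementary norm comparisons -/

lemma clipL2_eq_self {d : ℕ} {r : ℝ} {x : EuclideanSpace ℝ (Fin d)} (h : ‖x‖ ≤ r) :
    clipL2 r x = x := by
  -- At zero, `r / ‖x‖` is `0` by convention, so the factor need not be `1`; the zero vector is
  -- fixed all the same.
  by_cases hx : x = 0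
  · simp [clipL2, hx]
  · have : 1 ≤ r / ‖x‖ := (one_le_div (norm_pos_iff.2 hx)).2 h
    rw [clipL2, min_eq_left this, one_smul]

lemma shrink_eq_self {τ t : ℝ} (h : |t| ≤ τ) : shrink τ t = t := by
  rw [shrink, min_eq_left h]
  rcases lt_trichotomy t 0 with ht | ht | ht
  · rw [Real.sign_of_neg ht, abs_of_neg ht]; ring
  · simp [ht]
  · rw [Real.sign_of_pos ht, abs_of_pos ht]; ring

lemma norm_le_sqrt_card_mul {d : ℕ} {τ : ℝ} (hτ : 0 ≤ τ) {x : EuclideanSpace ℝ (Fin d)}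
    (h : ∀ j, |x j| ≤ τ) : ‖x‖ ≤ √d * τ := by
  rw [EuclideanSpace.norm_eq]
  refine Real.sqrt_le_iff.2 ⟨by positivity, ?_⟩
  rw [mul_pow, Real.sq_sqrt (Nat.cast_nonneg d)]
  calc ∑ j, ‖x j‖ ^ 2 ≤ ∑ _j : Fin d, τ ^ 2 :=
        Finset.sum_le_sum fun j _ => pow_le_pow_left₀ (norm_nonneg _) (h j) 2
    _ = d * τ ^ 2 := by simp

lemma norm_le_l1norm {d : ℕ} (θ : EuclideanSpace ℝ (Fin d)) : ‖θ‖ ≤ l1norm θ := by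
  have h0 : 0 ≤ l1norm θ := Finset.sum_nonneg fun j _ => abs_nonneg _
  rw [EuclideanSpace.norm_eq]
  refine Real.sqrt_le_iff.2 ⟨h0, ?_⟩
  calc ∑ j, ‖θ j‖ ^ 2 ≤ ∑ j, |θ j| * l1norm θ := by
        refine Finset.sum_le_sum fun j _ => ?_
        rw [Real.norm_eq_abs, sq]
        gcongr
        exact Finset.single_le_sum (f := fun j => |θ j|) (fun j _ => abs_nonneg _)
          (Finset.mem_univ j)
    _ = l1norm θ ^ 2 := by rw [← Finset.sum_mul, sq, l1norm]

/-- Hölder duality: since `θ` lies in the `ℓ₁` ball, the noise matrix applied to `θ` costs only the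
size of one noise entry, without a factor depending on `d`. -/
lemma abs_sum_mul_le_of_abs_le {d : ℕ} {θ : EuclideanSpace ℝ (Fin d)} (hθ : l1norm θ ≤ 1)
    {v : Fin d → ℝ} {T : ℝ} (hT : 0 ≤ T) (hv : ∀ k, |v k| ≤ T) : |∑ k, v k * θ k| ≤ T := by
  calc |∑ k, v k * θ k| ≤ ∑ k, |v k * θ k| := Finset.abs_sum_le_sum_abs _ _
    _ ≤ ∑ k, T * |θ k| := by
        refine Finset.sum_le_sum fun k _ => ?_
        rw [abs_mul]
        gcongr
        exact hv k
    _ = T * l1norm θ := by rw [← Finset.mul_sum, l1norm]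
    _ ≤ T := mul_le_of_le_one_right hT hθ

/-- Without clipping, the server's matrix is the sample second moment plus averaged noise. -/
lemma serverCov_reports_apply {d n : ℕ} {r τ : ℝ}
    {ω : (Fin n → EuclideanSpace ℝ (Fin d) × ℝ) × (Fin n → Noise d)}
    (hr : ∀ i, ‖(ω.1 i).1‖ ≤ r) (j k : Fin d) :
    serverCov (reports r τ τ ω) j k =
      (n : ℝ)⁻¹ * ∑ i, (ω.1 i).1 j * (ω.1 i).1 k +
        (n : ℝ)⁻¹ * ∑ i, (ω.2 i).1 (min j k) (max j k) := by
  rw [serverCov, Matrix.smul_apply, Matrix.sum_apply, smul_eq_mul, ← mul_add,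
    ← Finset.sum_add_distrib]
  congr 1
  refine Finset.sum_congr rfl fun i _ => ?_
  simp [reports, localReport, clipL2_eq_self (hr i), Matrix.vecMulVec_apply, symmOfUpper]

/-- Without clipping, the residual of the server's linear system is an average of `x ζ` up to
averaged noise. -/
lemma serverCross_sub_apply {d n : ℕ} {r τ : ℝ} (θ : EuclideanSpace ℝ (Fin d))
    {ω : (Fin n → EuclideanSpace ℝ (Fin d) × ℝ) × (Fin n → Noise d)}
    (hr : ∀ i, ‖(ω.1 i).1‖ ≤ r) (hx : ∀ i j, |(ω.1 i).1 j| ≤ τ) (hy : ∀ i, |(ω.1 i).2| ≤ τ)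
    (j : Fin d) :
    serverCross (reports r τ τ ω) j - (serverCov (reports r τ τ ω)).mulVec θ.ofLp j =
      (n : ℝ)⁻¹ * ∑ i, (ω.1 i).1 j * ((ω.1 i).2 - ⟪θ, (ω.1 i).1⟫) +
        (n : ℝ)⁻¹ * ∑ i, (ω.2 i).2 j -
        ∑ k, ((n : ℝ)⁻¹ * ∑ i, (ω.2 i).1 (min j k) (max j k)) * θ k := by
  have h1 : (serverCov (reports r τ τ ω)).mulVec θ.ofLp j =
      (n : ℝ)⁻¹ * ∑ i, (ω.1 i).1 j * ⟪θ, (ω.1 i).1⟫ +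
        ∑ k, ((n : ℝ)⁻¹ * ∑ i, (ω.2 i).1 (min j k) (max j k)) * θ k := by
    simp only [Matrix.mulVec, dotProduct, serverCov_reports_apply hr, add_mul,
      Finset.sum_add_distrib]
    congr 1
    simp only [PiLp.inner_apply, RCLike.inner_apply, conj_trivial, Finset.mul_sum,
      Finset.sum_mul]
    rw [Finset.sum_comm]
    refine Finset.sum_congr rfl fun i _ => Finset.sum_congr rfl fun k _ => ?_
    ring
  have h2 : serverCross (reports r τ τ ω) j =
      (n : ℝ)⁻¹ * ∑ i, (ω.1 i).1 j * (ω.1 i).2 + (n : ℝ)⁻¹ * ∑ i, (ω.2 i).2 j := by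
    rw [serverCross, Pi.smul_apply, Finset.sum_apply, smul_eq_mul, ← mul_add,
      ← Finset.sum_add_distrib]
    congr 1
    refine Finset.sum_congr rfl fun i _ => ?_
    simp [reports, localReport, shrink_eq_self (hx i j), shrink_eq_self (hy i)]
  rw [h1, h2]
  simp only [mul_sub, Finset.sum_sub_distrib]
  ring

/-! ### Probabilistic tools -/

section Tools

variable {α : Type*} [MeasurableSpace α] {μ : Measure α}

lemma pow_four_le_exp_add_exp (x : ℝ) : x ^ 4 ≤ 24 * (Real.exp x + Real.exp (-x)) := by
  have h := Real.pow_div_factorial_le_exp |x| (abs_nonneg x) 4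
  have h2 : |x| ^ 4 = x ^ 4 := by rw [← abs_pow, abs_of_nonneg (by positivity)]
  have h3 : Real.exp |x| ≤ Real.exp x + Real.exp (-x) := Real.exp_abs_le x
  rw [h2] at h
  norm_num [Nat.factorial] at h
  linarith

lemma integrable_pow_four {f : α → ℝ} (hf : MemLp f 4 μ) : Integrable (fun a => f a ^ 4) μ := by
  have := hf.integrable_norm_pow (by norm_num)
  simpa [Real.norm_eq_abs, Even.pow_abs (show Even 4 by decide)] using this

/-- The moment generating function at `±1/σ` is at most `exp (1/2) ≤ 2`, and it dominates the fourth
power up to `4! = 24`; hence `24 * (2 + 2) = 96`. -/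
lemma integral_pow_four_le {f : α → ℝ} {σ : ℝ≥0} (hσ : 0 < σ)
    (hf : HasSubgaussianMGF f (σ ^ 2) μ) : ∫ a, f a ^ 4 ∂μ ≤ 96 * σ ^ 4 := by
  have hσ' : (0 : ℝ) < σ := hσ
  have h1 := hf.integrable_exp_mul (σ : ℝ)⁻¹
  have h2 := hf.integrable_exp_mul (-(σ : ℝ)⁻¹)
  have hexp : Real.exp (1 / 2) ≤ 2 := by
    have h := Real.exp_one_lt_d9
    have e : Real.exp (1 / 2) ^ 2 = Real.exp 1 := by rw [← Real.exp_nat_mul]; norm_num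
    nlinarith [Real.exp_pos (1 / 2 : ℝ)]
  have b1 : ∫ a, Real.exp ((σ : ℝ)⁻¹ * f a) ∂μ ≤ 2 := by
    refine (hf.mgf_le (σ : ℝ)⁻¹).trans (le_trans (le_of_eq ?_) hexp)
    congr 1; push_cast; field_simp
  have b2 : ∫ a, Real.exp (-(σ : ℝ)⁻¹ * f a) ∂μ ≤ 2 := by
    refine (hf.mgf_le (-(σ : ℝ)⁻¹)).trans (le_trans (le_of_eq ?_) hexp)
    congr 1; push_cast; field_simp
  have hint := integrable_pow_four (hf.memLp 4)
  calc ∫ a, f a ^ 4 ∂μ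
      ≤ ∫ a, σ ^ 4 * (24 * (Real.exp ((σ : ℝ)⁻¹ * f a) + Real.exp (-(σ : ℝ)⁻¹ * f a))) ∂μ := by
        refine integral_mono hint (((h1.add h2).const_mul 24).const_mul _) fun a => ?_
        have h := pow_four_le_exp_add_exp ((σ : ℝ)⁻¹ * f a)
        have e : f a ^ 4 = (σ : ℝ) ^ 4 * ((σ : ℝ)⁻¹ * f a) ^ 4 := by field_simp
        simp only [neg_mul]
        rw [e]
        gcongr
    _ = σ ^ 4 * (24 * (∫ a, Real.exp ((σ : ℝ)⁻¹ * f a) ∂μ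
          + ∫ a, Real.exp (-(σ : ℝ)⁻¹ * f a) ∂μ)) := by
        rw [integral_const_mul, integral_const_mul, integral_add h1 h2]
    _ ≤ σ ^ 4 * (24 * (2 + 2)) := by gcongr
    _ = 96 * σ ^ 4 := by ring

/-- By AM–GM, `(f g)² ≤ (f⁴ + g⁴) / 2`: this turns fourth moments into the variance input for
Chebyshev. -/
lemma memLp_mul_and_integral_sq_le {f g : α → ℝ} (hf : MemLp f 4 μ) (hg : MemLp g 4 μ)
    {A B : ℝ} (hA : ∫ a, f a ^ 4 ∂μ ≤ A) (hB : ∫ a, g a ^ 4 ∂μ ≤ B) :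
    MemLp (fun a => f a * g a) 2 μ ∧ ∫ a, (f a * g a) ^ 2 ∂μ ≤ (A + B) / 2 := by
  have hmeas : AEStronglyMeasurable (fun a => f a * g a) μ :=
    hf.aestronglyMeasurable.mul hg.aestronglyMeasurable
  have hb : Integrable (fun a => (f a ^ 4 + g a ^ 4) / 2) μ :=
    ((integrable_pow_four hf).add (integrable_pow_four hg)).div_const 2
  have hle : ∀ a, (f a * g a) ^ 2 ≤ (f a ^ 4 + g a ^ 4) / 2 := fun a => by
    nlinarith [sq_nonneg (f a ^ 2 - g a ^ 2)]
  have hi : Integrable (fun a => (f a * g a) ^ 2) μ :=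
    hb.mono' (hmeas.pow 2) (ae_of_all _ fun a => by
      rw [Real.norm_of_nonneg (sq_nonneg _)]; exact hle a)
  refine ⟨(memLp_two_iff_integrable_sq hmeas).2 hi, (integral_mono hi hb hle).trans ?_⟩
  rw [integral_div, integral_add (integrable_pow_four hf) (integrable_pow_four hg)]
  linarith

lemma hasSubgaussianMGF_id_gaussianReal (v : ℝ≥0) :
    HasSubgaussianMGF (fun x : ℝ => x) v (gaussianReal 0 v) where
  integrable_exp_mul t := integrable_exp_mul_gaussianReal t
  mgf_le t := by
    have := congrFun (mgf_fun_id_gaussianReal (μ := 0) (v := v)) t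
    rw [this]; simp

/-! ### Concentration of empirical means under a product measure -/

variable [IsProbabilityMeasure μ]

lemma integral_avg_sub_sq_le {n : ℕ} (hn : 0 < n) {f : α → ℝ} (hf : MemLp f 2 μ) {M : ℝ}
    (hM : ∫ a, f a ^ 2 ∂μ ≤ M) :
    Integrable (fun ω : Fin n → α => ((n : ℝ)⁻¹ * ∑ i, f (ω i) - ∫ a, f a ∂μ) ^ 2)
        (Measure.pi fun _ => μ) ∧
      ∫ ω : Fin n → α, ((n : ℝ)⁻¹ * ∑ i, f (ω i) - ∫ a, f a ∂μ) ^ 2 ∂(Measure.pi fun _ => μ)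
        ≤ M / n := by
  have hn' : (0 : ℝ) < n := Nat.cast_pos.2 hn
  have hmp : ∀ i : Fin n, MeasurePreserving (Function.eval i) (Measure.pi fun _ : Fin n => μ) μ :=
    fun i => measurePreserving_eval _ i
  have hLi : ∀ i : Fin n, MemLp (fun ω : Fin n → α => f (ω i)) 2 (Measure.pi fun _ => μ) :=
    fun i => hf.comp_measurePreserving (hmp i)
  have hS : MemLp (fun ω : Fin n → α => (n : ℝ)⁻¹ * ∑ i, f (ω i)) 2 (Measure.pi fun _ => μ) :=
    (memLp_finsetSum _ fun i _ => hLi i).const_mul _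
  have hmean : ∫ ω : Fin n → α, (n : ℝ)⁻¹ * ∑ i, f (ω i) ∂(Measure.pi fun _ => μ)
      = ∫ a, f a ∂μ := by
    rw [integral_const_mul, integral_finsetSum _ fun i _ => (hLi i).integrable one_le_two]
    have : ∀ i : Fin n, ∫ ω : Fin n → α, f (ω i) ∂(Measure.pi fun _ => μ) = ∫ a, f a ∂μ := by
      intro i
      have h := integral_map (μ := Measure.pi fun _ : Fin n => μ) (f := f)
        (hmp i).measurable.aemeasurable (by rw [(hmp i).map_eq]; exact hf.aestronglyMeasurable)
      rw [(hmp i).map_eq] at h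
      exact h.symm
    simp only [this, Finset.sum_const, Finset.card_univ, Fintype.card_fin, nsmul_eq_mul]
    field_simp
  refine ⟨(hS.sub (memLp_const _)).integrable_sq, ?_⟩
  have hv := variance_eq_integral hS.aestronglyMeasurable.aemeasurable
  rw [hmean] at hv
  rw [← hv, variance_const_mul]
  have hsum : Var[fun ω : Fin n → α => ∑ i, f (ω i); Measure.pi fun _ => μ] = n * Var[f; μ] := by
    have h := variance_sum_pi (ι := Fin n) (μ := fun _ => μ) (X := fun _ => f) fun _ => hf
    have e : (∑ i, fun ω : Fin n → α => f (ω i)) = fun ω : Fin n → α => ∑ i, f (ω i) := by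
      ext ω; simp
    rw [e] at h
    simpa using h
  rw [hsum]
  have hvar : Var[f; μ] ≤ M :=
    (variance_le_expectation_sq hf.aestronglyMeasurable).trans (by simpa using hM)
  calc (n : ℝ)⁻¹ ^ 2 * (n * Var[f; μ]) = Var[f; μ] / n := by field_simp
    _ ≤ M / n := by gcongr

/-- Chebyshev's inequality for the Euclidean norm of the deviation of an empirical mean. -/
lemma measureReal_le_sum_avg_sub_sq {ι : Type*} [Fintype ι] {n : ℕ} (hn : 0 < n) {f : ι → α → ℝ}
    (hf : ∀ a, MemLp (f a) 2 μ) {M : ℝ} (hM : ∀ a, ∫ z, f a z ^ 2 ∂μ ≤ M) {t : ℝ} (ht : 0 < t) :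
    (Measure.pi fun _ : Fin n => μ).real
        {ω | t ≤ ∑ a, ((n : ℝ)⁻¹ * ∑ i, f a (ω i) - ∫ z, f a z ∂μ) ^ 2}
      ≤ Fintype.card ι * (M / n) / t := by
  rw [le_div_iff₀ ht, mul_comm]
  refine (mul_meas_ge_le_integral_of_nonneg
    (ae_of_all _ fun ω => Finset.sum_nonneg fun a _ => sq_nonneg _)
    (integrable_finsetSum _ fun a _ => (integral_avg_sub_sq_le hn (hf a) (hM a)).1) t).trans ?_
  rw [integral_finsetSum _ fun a _ => (integral_avg_sub_sq_le hn (hf a) (hM a)).1]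
  refine (Finset.sum_le_sum fun a _ => (integral_avg_sub_sq_le hn (hf a) (hM a)).2).trans ?_
  simp

lemma measureReal_le_abs_of_hasSubgaussianMGF {f : α → ℝ} {c : ℝ≥0}
    (hf : HasSubgaussianMGF f c μ) {t : ℝ} (ht : 0 ≤ t) :
    μ.real {a | t ≤ |f a|} ≤ 2 * Real.exp (-t ^ 2 / (2 * c)) := by
  have hsub : {a | t ≤ |f a|} ⊆ {a | t ≤ f a} ∪ {a | t ≤ (-f) a} := fun a ha => by
    rcases le_abs.1 (show t ≤ |f a| from ha) with h | h
    · exact Or.inl h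
    · exact Or.inr h
  calc μ.real {a | t ≤ |f a|} ≤ μ.real ({a | t ≤ f a} ∪ {a | t ≤ (-f) a}) := measureReal_mono hsub
    _ ≤ μ.real {a | t ≤ f a} + μ.real {a | t ≤ (-f) a} := measureReal_union_le _ _
    _ ≤ _ := by linarith [hf.measure_ge_le ht, hf.neg.measure_ge_le ht]

lemma HasSubgaussianMGF.comp_eval {n : ℕ} {f : α → ℝ} {c : ℝ≥0}
    (hf : HasSubgaussianMGF f c μ) (i : Fin n) :
    HasSubgaussianMGF (fun ω : Fin n → α => f (ω i)) c (Measure.pi fun _ => μ) := by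
  have hmp := measurePreserving_eval (fun _ : Fin n => μ) i
  refine ProbabilityTheory.HasSubgaussianMGF.of_map (Y := Function.eval i) (X := f)
    hmp.measurable.aemeasurable ?_
  rwa [hmp.map_eq]

/-- A two-sided Hoeffding bound for the empirical mean of a sub-Gaussian function. -/
lemma measureReal_le_abs_avg {n : ℕ} (hn : 0 < n) {f : α → ℝ} {c : ℝ≥0}
    (hf : HasSubgaussianMGF f c μ) {t : ℝ} (ht : 0 ≤ t) :
    (Measure.pi fun _ : Fin n => μ).real {ω | t ≤ |(n : ℝ)⁻¹ * ∑ i, f (ω i)|}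
      ≤ 2 * Real.exp (-(n * t ^ 2) / (2 * c)) := by
  have hn' : (0 : ℝ) < n := Nat.cast_pos.2 hn
  have hs : HasSubgaussianMGF (fun ω : Fin n → α => ∑ i, f (ω i)) (∑ _i : Fin n, c)
      (Measure.pi fun _ => μ) :=
    HasSubgaussianMGF.sum_of_iIndepFun
      (iIndepFun_pi (X := fun _ : Fin n => f) fun _ => hf.aemeasurable)
      fun i _ => HasSubgaussianMGF.comp_eval hf i
  have h := measureReal_le_abs_of_hasSubgaussianMGF hs (t := n * t) (by positivity)
  have e : {ω : Fin n → α | t ≤ |(n : ℝ)⁻¹ * ∑ i, f (ω i)|}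
      = {ω | n * t ≤ |∑ i, f (ω i)|} := by
    ext ω
    simp only [Set.mem_ofPred_eq, abs_mul, abs_inv, Nat.abs_cast]
    rw [inv_mul_eq_div, le_div_iff₀ hn', mul_comm]
  rw [e]
  refine h.trans (le_of_eq ?_)
  congr 2
  simp only [Finset.sum_const, Finset.card_univ, Fintype.card_fin, nsmul_eq_mul, NNReal.coe_mul,
    NNReal.coe_natCast]
  -- When `c = 0` both exponents are divisions by zero, hence equal to `0`.
  by_cases hc : (c : ℝ) = 0
  · simp [hc]
  · field_simp

lemma measureReal_exists_le_abs {n : ℕ} {f : α → ℝ} {c : ℝ≥0} (hf : HasSubgaussianMGF f c μ)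
    {t : ℝ} (ht : 0 ≤ t) :
    (Measure.pi fun _ : Fin n => μ).real {ω | ∃ i, t ≤ |f (ω i)|}
      ≤ n * (2 * Real.exp (-t ^ 2 / (2 * c))) := by
  rw [Set.ofPred_exists]
  refine (measureReal_iUnion_fintype_le _).trans ?_
  refine (Finset.sum_le_sum fun i _ =>
    measureReal_le_abs_of_hasSubgaussianMGF (HasSubgaussianMGF.comp_eval hf i) ht).trans ?_
  simp

end Tools

/-! ### Moments in the sparse linear model -/

section Model

variable {d : ℕ} {P : Measure (EuclideanSpace ℝ (Fin d) × ℝ)}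
  {θ : EuclideanSpace ℝ (Fin d)} {k : ℕ} {σ : ℝ≥0}

lemma SubGaussianAssumption.hasSubgaussianMGF_apply (h : SubGaussianAssumption P σ) (j : Fin d) :
    HasSubgaussianMGF (fun z => z.1 j) (σ ^ 2) P := by
  have := h.subG_x (EuclideanSpace.single j 1) (by simp)
  simpa [EuclideanSpace.inner_single_right] using this

lemma SubGaussianAssumption.inner_pow_four (h : SubGaussianAssumption P σ) (hσ : 0 < σ)
    (hθ : ‖θ‖ ≤ 1) :
    MemLp (fun z : EuclideanSpace ℝ (Fin d) × ℝ => ⟪θ, z.1⟫) 4 P ∧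
      ∫ z, ⟪θ, z.1⟫ ^ 4 ∂P ≤ 96 * σ ^ 4 := by
  by_cases h0 : θ = 0
  · simp only [h0, inner_zero_left]
    refine ⟨MemLp.zero, ?_⟩
    simp only [ne_eq, OfNat.ofNat_ne_zero, not_false_eq_true, zero_pow, integral_zero]
    positivity
  · have hpos : 0 < ‖θ‖ := norm_pos_iff.2 h0
    -- The sub-Gaussian assumption concerns unit vectors only, so `θ` is normalised.
    set u : EuclideanSpace ℝ (Fin d) := ‖θ‖⁻¹ • θ with hu
    have hsub := h.subG_x u (by rw [hu, norm_smul, norm_inv, norm_norm, inv_mul_cancel₀ hpos.ne'])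
    have e : ∀ z : EuclideanSpace ℝ (Fin d) × ℝ, ⟪θ, z.1⟫ = ‖θ‖ * ⟪z.1, u⟫ := fun z => by
      rw [hu, inner_smul_right, real_inner_comm]
      field_simp
    simp only [e, mul_pow]
    refine ⟨(hsub.memLp 4).const_mul _, ?_⟩
    rw [integral_const_mul]
    have h4 := integral_pow_four_le hσ hsub
    have h1 : ‖θ‖ ^ 4 ≤ 1 := pow_le_one₀ hpos.le hθ
    have h2 : 0 ≤ ∫ z : EuclideanSpace ℝ (Fin d) × ℝ, ⟪z.1, u⟫ ^ 4 ∂P :=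
      integral_nonneg fun z => by positivity
    nlinarith

/-- From `(a - b)⁴ ≤ 8 (a⁴ + b⁴)`, with `8 * (96 + 96) = 1536`. -/
lemma SubGaussianAssumption.noise_pow_four (h : SubGaussianAssumption P σ) (hσ : 0 < σ)
    (hθ : ‖θ‖ ≤ 1) :
    MemLp (fun z : EuclideanSpace ℝ (Fin d) × ℝ => z.2 - ⟪θ, z.1⟫) 4 P ∧
      ∫ z, (z.2 - ⟪θ, z.1⟫) ^ 4 ∂P ≤ 1536 * σ ^ 4 := by
  obtain ⟨hL, hI⟩ := h.inner_pow_four (θ := θ) hσ hθ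
  have hy : MemLp (fun z : EuclideanSpace ℝ (Fin d) × ℝ => z.2) 4 P := h.subG_y.memLp 4
  have hyI := integral_pow_four_le hσ h.subG_y
  have hm := hy.sub hL
  refine ⟨hm, ?_⟩
  have hle : ∀ z : EuclideanSpace ℝ (Fin d) × ℝ,
      (z.2 - ⟪θ, z.1⟫) ^ 4 ≤ 8 * (z.2 ^ 4 + ⟪θ, z.1⟫ ^ 4) := fun z => by
    generalize z.2 = a
    generalize ⟪θ, z.1⟫ = b
    have h1 : (a - b) ^ 2 ≤ 2 * (a ^ 2 + b ^ 2) := by nlinarith [sq_nonneg (a + b)]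
    have h2 : ((a - b) ^ 2) ^ 2 ≤ (2 * (a ^ 2 + b ^ 2)) ^ 2 :=
      pow_le_pow_left₀ (sq_nonneg _) h1 2
    nlinarith [sq_nonneg (a ^ 2 - b ^ 2)]
  refine (integral_mono (integrable_pow_four hm)
    (((integrable_pow_four hy).add (integrable_pow_four hL)).const_mul 8) hle).trans ?_
  simp only [Pi.add_apply]
  rw [integral_const_mul, integral_add (integrable_pow_four hy) (integrable_pow_four hL)]
  linarith

/-- The coordinate is measurable with respect to `x`, so it can be pulled out of `E[· | x]`, leaving
a multiple of `E[ζ | x] = 0`. Independence of `ζ` and `x` is not required. -/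
lemma IsSparseLinearModel.integral_mul_noise [IsProbabilityMeasure P]
    (hM : IsSparseLinearModel P θ k) (j : Fin d)
    (hint : Integrable (fun z : EuclideanSpace ℝ (Fin d) × ℝ => z.1 j * (z.2 - ⟪θ, z.1⟫)) P) :
    ∫ z, z.1 j * (z.2 - ⟪θ, z.1⟫) ∂P = 0 := by
  have hm : MeasurableSpace.comap (Prod.fst : EuclideanSpace ℝ (Fin d) × ℝ → _) inferInstance
      ≤ (inferInstance : MeasurableSpace (EuclideanSpace ℝ (Fin d) × ℝ)) :=
    measurable_fst.comap_le
  have hsm : StronglyMeasurable[MeasurableSpace.comap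
      (Prod.fst : EuclideanSpace ℝ (Fin d) × ℝ → _) inferInstance]
      (fun z : EuclideanSpace ℝ (Fin d) × ℝ => z.1 j) := by
    have h1 : Measurable fun x : EuclideanSpace ℝ (Fin d) => x j := by fun_prop
    exact (h1.comp (comap_measurable Prod.fst)).stronglyMeasurable
  have hpull := condExp_mul_of_stronglyMeasurable_left (μ := P) hsm (g := fun z => z.2 - ⟪θ, z.1⟫)
    hint hM.integrable_noise
  have h0 : P[(fun z : EuclideanSpace ℝ (Fin d) × ℝ => z.1 j) * (fun z => z.2 - ⟪θ, z.1⟫) |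
      MeasurableSpace.comap Prod.fst inferInstance] =ᵐ[P] 0 := by
    filter_upwards [hpull, hM.condExp_noise] with z h1 h2
    rw [h1, Pi.mul_apply, h2]
    simp
  have h := integral_condExp (μ := P) hm
    (f := (fun z : EuclideanSpace ℝ (Fin d) × ℝ => z.1 j) * (fun z => z.2 - ⟪θ, z.1⟫))
  rw [integral_congr_ae h0] at h
  simpa using h.symm

lemma covMat_apply_eq [IsProbabilityMeasure P] (h : SubGaussianAssumption P σ)
    (hx : Integrable (fun z => z.1) P) (i j : Fin d) : covMat P i j = ∫ z, z.1 i * z.1 j ∂P := by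
  have hmean : ∀ i, ∫ z, z.1 i ∂P = 0 := fun i => by
    have := (EuclideanSpace.proj i : EuclideanSpace ℝ (Fin d) →L[ℝ] ℝ).integral_comp_comm hx
    rw [h.mean_x, map_zero] at this
    exact this
  have hL : ∀ i, MemLp (fun z : EuclideanSpace ℝ (Fin d) × ℝ => z.1 i) 2 P :=
    fun i => (h.hasSubgaussianMGF_apply i).memLp 2
  rw [covMat, Matrix.of_apply, covariance_eq_sub (hL i) (hL j), hmean]
  simp

end Model

/-! ### The noise -/

section Noise

variable {d : ℕ} {r τ₁ τ₂ ε δ : ℝ}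

instance isProbabilityMeasure_noiseLaw : IsProbabilityMeasure (noiseLaw d r τ₁ τ₂ ε δ) := by
  unfold noiseLaw; infer_instance

lemma hasSubgaussianMGF_noise_matrix (j k : Fin d) :
    HasSubgaussianMGF (fun N : Noise d => N.1 j k)
      (Real.toNNReal (32 * r ^ 4 * Real.log (2.5 / δ) / ε ^ 2)) (noiseLaw d r τ₁ τ₂ ε δ) := by
  set v := Real.toNNReal (32 * r ^ 4 * Real.log (2.5 / δ) / ε ^ 2)
  have h1 : MeasurePreserving Prod.fst (noiseLaw d r τ₁ τ₂ ε δ)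
      (Measure.pi fun _ : Fin d => Measure.pi fun _ : Fin d => gaussianReal 0 v) :=
    measurePreserving_fst
  have h2 := (measurePreserving_eval
    (fun _ : Fin d => Measure.pi fun _ : Fin d => gaussianReal 0 v) j).comp h1
  have h3 : MeasurePreserving (fun N : Noise d => N.1 j k) (noiseLaw d r τ₁ τ₂ ε δ)
      (gaussianReal 0 v) := (measurePreserving_eval (fun _ : Fin d => gaussianReal 0 v) k).comp h2
  refine HasSubgaussianMGF.of_map (X := fun x : ℝ => x) h3.measurable.aemeasurable ?_
  rw [h3.map_eq]
  exact hasSubgaussianMGF_id_gaussianReal v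

lemma hasSubgaussianMGF_noise_vector (j : Fin d) :
    HasSubgaussianMGF (fun N : Noise d => N.2 j)
      (Real.toNNReal (32 * d * τ₁ ^ 2 * τ₂ ^ 2 * Real.log (2.5 / δ) / ε ^ 2))
      (noiseLaw d r τ₁ τ₂ ε δ) := by
  set v := Real.toNNReal (32 * d * τ₁ ^ 2 * τ₂ ^ 2 * Real.log (2.5 / δ) / ε ^ 2)
  have h1 : MeasurePreserving Prod.snd (noiseLaw d r τ₁ τ₂ ε δ)
      (Measure.pi fun _ : Fin d => gaussianReal 0 v) := measurePreserving_snd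
  have h3 : MeasurePreserving (fun N : Noise d => N.2 j) (noiseLaw d r τ₁ τ₂ ε δ)
      (gaussianReal 0 v) := (measurePreserving_eval (fun _ : Fin d => gaussianReal 0 v) j).comp h1
  refine HasSubgaussianMGF.of_map (X := fun x : ℝ => x) h3.measurable.aemeasurable ?_
  rw [h3.map_eq]
  exact hasSubgaussianMGF_id_gaussianReal v

end Noise

/-- The success set and the two bad cylinders cover the whole space, so subadditivity suffices and
no set has to be measurable. -/
lemma one_sub_le_measureReal_prod {α β : Type*} [MeasurableSpace α] [MeasurableSpace β]
    {μ : Measure α} {ν : Measure β} [IsProbabilityMeasure μ] [IsProbabilityMeasure ν]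
    {A : Set α} {B : Set β} {G : Set (α × β)} (h : ∀ ω, ω.1 ∉ A → ω.2 ∉ B → ω ∈ G) :
    1 - (μ.real A + ν.real B) ≤ (μ.prod ν).real G := by
  have hcov : (Set.univ : Set (α × β)) ⊆ G ∪ (A ×ˢ Set.univ ∪ Set.univ ×ˢ B) := fun ω _ => by
    by_cases hA : ω.1 ∈ A
    · exact Or.inr (Or.inl ⟨hA, trivial⟩)
    by_cases hB : ω.2 ∈ B
    · exact Or.inr (Or.inr ⟨trivial, hB⟩)
    · exact Or.inl (h ω hA hB)
  have h1 := measureReal_mono (μ := μ.prod ν) hcov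
  have h2 := measureReal_union_le (μ := μ.prod ν) G (A ×ˢ Set.univ ∪ Set.univ ×ˢ B)
  have h3 := measureReal_union_le (μ := μ.prod ν) (A ×ˢ Set.univ) (Set.univ ×ˢ B)
  rw [measureReal_prod_prod, measureReal_prod_prod] at h3
  simp only [probReal_univ, mul_one, one_mul] at h1 h3
  linarith

/-- The estimator succeeds on every outcome without clipping on which the sample and noise averages
are close to their means. -/
lemma estimate_of_no_clipping {d n k : ℕ} {r τ κ T g lam : ℝ} {S : Matrix (Fin d) (Fin d) ℝ}
    {θ : EuclideanSpace ℝ (Fin d)}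
    {ω : (Fin n → EuclideanSpace ℝ (Fin d) × ℝ) × (Fin n → Noise d)}
    (hκ : 0 < κ) (hS : ∀ w : Fin d → ℝ, κ * ‖w‖ ≤ ‖S.mulVec w‖)
    (hθ : l1norm θ ≤ 1) (hk : l0norm θ ≤ k)
    (hr : ∀ i, ‖(ω.1 i).1‖ ≤ r) (hx : ∀ i j, |(ω.1 i).1 j| ≤ τ) (hy : ∀ i, |(ω.1 i).2| ≤ τ)
    (hE : d * ∑ p : Fin d × Fin d,
      ((n : ℝ)⁻¹ * ∑ i, (ω.1 i).1 p.1 * (ω.1 i).1 p.2 - S p.1 p.2) ^ 2 ≤ (κ / 4) ^ 2)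
    (hg : ∀ j, |(n : ℝ)⁻¹ * ∑ i, (ω.1 i).1 j * ((ω.1 i).2 - ⟪θ, (ω.1 i).1⟫)| ≤ g)
    (hN₁ : ∀ j l, |(n : ℝ)⁻¹ * ∑ i, (ω.2 i).1 j l| ≤ T)
    (hN₂ : ∀ j, |(n : ℝ)⁻¹ * ∑ i, (ω.2 i).2 j| ≤ T)
    (hT : 0 ≤ T) (hdT : d * T ≤ κ / 4) (hlam : 0 ≤ lam) (hgl : g + 2 * T ≤ κ / 2 * lam) :
    IsUnit (serverCov (reports r τ τ ω)).det ∧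
      ‖serverEstimate lam (reports r τ τ ω) - θ‖ ≤ 2 * lam * √k := by
  set A := serverCov (reports r τ τ ω) with hAdef
  have hκ2 : 0 < κ / 2 := by linarith
  -- Half of the margin `κ / 2` pays for the sampling error, the other half for `d` noise entries of
  -- size `T`.
  have hrow : ∀ j, ∑ l, |(A - S) j l| ≤ κ / 2 := fun j => by
    have h1 := row_sum_abs_le_of_sum_sq_le (B := Matrix.of fun j l =>
      (n : ℝ)⁻¹ * ∑ i, (ω.1 i).1 j * (ω.1 i).1 l - S j l) (by linarith : 0 ≤ κ / 4) hE j
    simp only [Matrix.of_apply] at h1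
    calc ∑ l, |(A - S) j l|
        ≤ ∑ l, (|(n : ℝ)⁻¹ * ∑ i, (ω.1 i).1 j * (ω.1 i).1 l - S j l| + T) := by
          refine Finset.sum_le_sum fun l _ => ?_
          rw [Matrix.sub_apply, hAdef, serverCov_reports_apply hr, add_sub_right_comm]
          exact (abs_add_le _ _).trans (by linarith [hN₁ (min j l) (max j l)])
      _ ≤ κ / 4 + κ / 4 := by
          rw [Finset.sum_add_distrib]
          refine add_le_add h1 ?_
          simpa using hdT
      _ = κ / 2 := by ring
  have hA : ∀ w : Fin d → ℝ, κ / 2 * ‖w‖ ≤ ‖A.mulVec w‖ := fun w => by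
    have h := le_norm_add_mulVec hS (norm_mulVec_le_of_row_sum_le hκ2.le hrow) w
    rw [add_sub_cancel] at h
    linarith
  refine ⟨isUnit_det_of_le_norm_mulVec hκ2 hA, norm_softThreshold_sub_le hlam (fun j => ?_) hk⟩
  refine abs_inv_mulVec_sub_le hκ2 hA hlam (fun j => ?_) j
  rw [hAdef, serverCross_sub_apply θ hr hx hy]
  have h3 := abs_sum_mul_le_of_abs_le hθ hT fun l => hN₁ (min j l) (max j l)
  refine (abs_sub _ _).trans ?_
  linarith [abs_add_le ((n : ℝ)⁻¹ * ∑ i, (ω.1 i).1 j * ((ω.1 i).2 - ⟪θ, (ω.1 i).1⟫))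
    ((n : ℝ)⁻¹ * ∑ i, (ω.2 i).2 j), hg j, hN₂ j]

/-! ### The bad events -/

section BadEvents

variable {d n k : ℕ} {P : Measure (EuclideanSpace ℝ (Fin d) × ℝ)} [IsProbabilityMeasure P]
  {θ : EuclideanSpace ℝ (Fin d)} {σ : ℝ≥0}

/-- The threshold makes each tail `2 / n²`; a union over `n` samples and `d + 1` variables gives `2
(d + 1) / n`. -/
lemma measureReal_clip_le (hd : 1 ≤ d) (hn : 2 ≤ n) (hσ : 0 < σ) (h : SubGaussianAssumption P σ)
    {τ : ℝ} (hτ : τ = 2 * (σ * √(Real.log n))) :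
    (Measure.pi fun _ : Fin n => P).real
        ({ω | ∃ j : Fin d, ∃ i, τ ≤ |(ω i).1 j|} ∪ {ω | ∃ i, τ ≤ |(ω i).2|}) ≤ 4 * d / n := by
  have hn' : (0 : ℝ) < n := by positivity
  have hσ' : (0 : ℝ) < σ := hσ
  have hlog : 0 ≤ Real.log n := Real.log_natCast_nonneg n
  have hτ0 : 0 ≤ τ := by rw [hτ]; positivity
  have hexp : (n : ℝ) * (2 * Real.exp (-τ ^ 2 / (2 * ((σ ^ 2 : ℝ≥0) : ℝ)))) = 2 / n := by
    have e : -τ ^ 2 / (2 * ((σ ^ 2 : ℝ≥0) : ℝ)) = -(Real.log n + Real.log n) := by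
      rw [hτ, mul_pow, mul_pow, Real.sq_sqrt hlog]
      push_cast
      field_simp
      ring
    rw [e, Real.exp_neg, Real.exp_add, Real.exp_log hn']
    field_simp
  refine (measureReal_union_le _ _).trans ?_
  have h1 : (Measure.pi fun _ : Fin n => P).real {ω | ∃ j : Fin d, ∃ i, τ ≤ |(ω i).1 j|}
      ≤ d * (2 / n) := by
    rw [Set.ofPred_exists]
    refine (measureReal_iUnion_fintype_le _).trans ?_
    refine (Finset.sum_le_sum fun j _ =>
      (measureReal_exists_le_abs (h.hasSubgaussianMGF_apply j) hτ0).trans hexp.le).trans ?_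
    simp
  have h2 := (measureReal_exists_le_abs (n := n) h.subG_y hτ0).trans hexp.le
  have hd' : (1 : ℝ) ≤ d := by exact_mod_cast hd
  calc _ ≤ d * (2 / n : ℝ) + 2 / n := add_le_add h1 h2
    _ = 2 * (d + 1) / n := by ring
    _ ≤ 4 * d / n := div_le_div_of_nonneg_right (by linarith) hn'.le

lemma measureReal_sampleCov_le (hn : 2 ≤ n) (hσ : 0 < σ) (h : SubGaussianAssumption P σ)
    (hx : Integrable (fun z => z.1) P) {t : ℝ} (ht : 0 < t) :
    (Measure.pi fun _ : Fin n => P).real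
        {ω | t ≤ ∑ p : Fin d × Fin d,
          ((n : ℝ)⁻¹ * ∑ i, (ω i).1 p.1 * (ω i).1 p.2 - covMat P p.1 p.2) ^ 2}
      ≤ d ^ 2 * (816 * σ ^ 4 / n) / t := by
  have hm : ∀ p : Fin d × Fin d, MemLp (fun z => z.1 p.1 * z.1 p.2) 2 P ∧
      ∫ z, (z.1 p.1 * z.1 p.2) ^ 2 ∂P ≤ (96 * σ ^ 4 + 96 * σ ^ 4) / 2 := fun p =>
    memLp_mul_and_integral_sq_le ((h.hasSubgaussianMGF_apply p.1).memLp 4)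
      ((h.hasSubgaussianMGF_apply p.2).memLp 4)
      (integral_pow_four_le hσ (h.hasSubgaussianMGF_apply p.1))
      (integral_pow_four_le hσ (h.hasSubgaussianMGF_apply p.2))
  have hσ4 : (0 : ℝ) ≤ (σ : ℝ) ^ 4 := by positivity
  -- `816 = (96 + 1536) / 2` is the constant for the residual; the smaller `96` is relaxed to it.
  have := measureReal_le_sum_avg_sub_sq (by omega : 0 < n) (fun p => (hm p).1)
    (M := 816 * σ ^ 4) (fun p => (hm p).2.trans (by linarith)) ht
  simpa only [covMat_apply_eq h hx, Fintype.card_prod, Fintype.card_fin, Nat.cast_mul, ← sq,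
    Nat.cast_pow]
    using this

lemma measureReal_residual_le (hn : 2 ≤ n) (hσ : 0 < σ) (h : SubGaussianAssumption P σ)
    (hM : IsSparseLinearModel P θ k) (hθ : l1norm θ ≤ 1) {t : ℝ} (ht : 0 < t) :
    (Measure.pi fun _ : Fin n => P).real
        {ω | t ≤ ∑ j, ((n : ℝ)⁻¹ * ∑ i, (ω i).1 j * ((ω i).2 - ⟪θ, (ω i).1⟫)) ^ 2}
      ≤ d * (816 * σ ^ 4 / n) / t := by
  obtain ⟨hL, hI⟩ := h.noise_pow_four hσ ((norm_le_l1norm θ).trans hθ)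
  have hm : ∀ j, MemLp (fun z => z.1 j * (z.2 - ⟪θ, z.1⟫)) 2 P ∧
      ∫ z, (z.1 j * (z.2 - ⟪θ, z.1⟫)) ^ 2 ∂P ≤ (96 * σ ^ 4 + 1536 * σ ^ 4) / 2 := fun j =>
    memLp_mul_and_integral_sq_le ((h.hasSubgaussianMGF_apply j).memLp 4) hL
      (integral_pow_four_le hσ (h.hasSubgaussianMGF_apply j)) hI
  have := measureReal_le_sum_avg_sub_sq (by omega : 0 < n) (fun j => (hm j).1)
    (M := 816 * σ ^ 4) (fun j => (hm j).2.trans (by linarith)) ht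
  simpa only [hM.integral_mul_noise _ ((hm _).1.integrable one_le_two), sub_zero,
    Fintype.card_fin] using this

/-- Averaged sub-Gaussian noise with variance proxy at most `V` exceeds `√(8 V log d / n)` with
probability at most `2 / d ^ 4`. -/
lemma measureReal_noise_avg_le {α : Type*} [MeasurableSpace α] {μ : Measure α}
    [IsProbabilityMeasure μ] (hd : 1 ≤ d) (hn : 2 ≤ n) {f : α → ℝ} {v V T : ℝ}
    (hf : HasSubgaussianMGF f v.toNNReal μ) (hv : 0 < v) (hvV : v ≤ V) (hT : 0 ≤ T)
    (hTV : n * T ^ 2 = 8 * Real.log d * V) :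
    (Measure.pi fun _ : Fin n => μ).real {ω | T ≤ |(n : ℝ)⁻¹ * ∑ i, f (ω i)|} ≤ 2 / d ^ 4 := by
  have hd' : (0 : ℝ) < d := by positivity
  have hlog : 0 ≤ Real.log d := Real.log_natCast_nonneg d
  refine (measureReal_le_abs_avg (by omega) hf hT).trans ?_
  rw [hTV, Real.coe_toNNReal v hv.le, div_eq_mul_inv 2]
  gcongr
  have e : ((d : ℝ) ^ 4)⁻¹ = Real.exp (-(4 * Real.log d)) := by
    rw [Real.exp_neg, show (4 : ℝ) * Real.log d = (4 : ℕ) * Real.log d by norm_num,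
      Real.exp_nat_mul, Real.exp_log hd']
  rw [e]
  refine Real.exp_le_exp.2 ?_
  rw [neg_div, neg_le_neg_iff, le_div_iff₀ (by positivity)]
  nlinarith

lemma measureReal_exists_noise_avg_le {α ι : Type*} [MeasurableSpace α] [Fintype ι]
    {μ : Measure α} [IsProbabilityMeasure μ] (hd : 1 ≤ d) (hn : 2 ≤ n) {f : ι → α → ℝ}
    {v V T : ℝ} (hf : ∀ a, HasSubgaussianMGF (f a) v.toNNReal μ) (hv : 0 < v) (hvV : v ≤ V)
    (hT : 0 ≤ T) (hTV : n * T ^ 2 = 8 * Real.log d * V) :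
    (Measure.pi fun _ : Fin n => μ).real {ω | ∃ a, T ≤ |(n : ℝ)⁻¹ * ∑ i, f a (ω i)|}
      ≤ Fintype.card ι * (2 / d ^ 4) := by
  rw [Set.ofPred_exists]
  refine (measureReal_iUnion_fintype_le _).trans ((Finset.sum_le_sum fun a _ =>
    measureReal_noise_avg_le hd hn (hf a) hv hvV hT hTV).trans ?_)
  simp

/-- Each average fails with probability at most `2 / d⁴`, which leaves room for a union over all
`d²` matrix entries and `d` vector entries. -/
lemma measureReal_noise_le {r τ ε δ V T : ℝ} (hd : 1 ≤ d) (hn : 2 ≤ n)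
    (hv₁ : 0 < 32 * r ^ 4 * Real.log (2.5 / δ) / ε ^ 2)
    (hv₁V : 32 * r ^ 4 * Real.log (2.5 / δ) / ε ^ 2 ≤ V)
    (hv₂ : 0 < 32 * d * τ ^ 2 * τ ^ 2 * Real.log (2.5 / δ) / ε ^ 2)
    (hv₂V : 32 * d * τ ^ 2 * τ ^ 2 * Real.log (2.5 / δ) / ε ^ 2 ≤ V)
    (hT : 0 ≤ T) (hTV : n * T ^ 2 = 8 * Real.log d * V) :
    (Measure.pi fun _ : Fin n => noiseLaw d r τ τ ε δ).real
        ({ω | ∃ p : Fin d × Fin d, T ≤ |(n : ℝ)⁻¹ * ∑ i, (ω i).1 p.1 p.2|} ∪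
          {ω | ∃ j : Fin d, T ≤ |(n : ℝ)⁻¹ * ∑ i, (ω i).2 j|}) ≤ 4 / d := by
  have hd' : (1 : ℝ) ≤ d := by exact_mod_cast hd
  refine (measureReal_union_le _ _).trans ?_
  have h1 := measureReal_exists_noise_avg_le (μ := noiseLaw d r τ τ ε δ)
    (f := fun (p : Fin d × Fin d) N => N.1 p.1 p.2) hd hn
    (fun p => hasSubgaussianMGF_noise_matrix p.1 p.2) hv₁ hv₁V hT hTV
  have h2 := measureReal_exists_noise_avg_le (μ := noiseLaw d r τ τ ε δ)
    (f := fun (j : Fin d) N => N.2 j) hd hn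
    (fun j => hasSubgaussianMGF_noise_vector j) hv₂ hv₂V hT hTV
  rw [Fintype.card_prod, Fintype.card_fin, Nat.cast_mul] at h1
  rw [Fintype.card_fin] at h2
  have h3 : (d : ℝ) * (2 / d ^ 4) ≤ 2 / d := by
    rw [mul_div_assoc', div_le_div_iff₀ (by positivity) (by positivity)]
    have : (d : ℝ) ^ 2 ≤ d ^ 4 := pow_le_pow_right₀ hd' (by norm_num)
    nlinarith
  have h4 : (d : ℝ) * d * (2 / d ^ 4) ≤ 2 / d := by
    rw [mul_div_assoc', div_le_div_iff₀ (by positivity) (by positivity)]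
    have : (d : ℝ) ^ 3 ≤ d ^ 4 := pow_le_pow_right₀ hd' (by norm_num)
    nlinarith
  calc _ ≤ d * d * (2 / d ^ 4) + d * (2 / d ^ 4 : ℝ) := add_le_add h1 h2
    _ ≤ 2 / d + 2 / d := add_le_add h4 h3
    _ = 4 / d := by ring

end BadEvents

/-! ### Rates, constants and failure probability -/

lemma half_le_log_natCast {m : ℕ} (hm : 2 ≤ m) : 1 / 2 ≤ Real.log m := by
  have h1 : Real.log 2 ≤ Real.log m := Real.log_le_log (by norm_num) (by exact_mod_cast hm)
  linarith [Real.log_two_gt_d9]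

/-- Because `δ ≤ δ₀ < 1`, `log (1/δ)` is bounded away from zero and absorbs the additive `log 2.5`;
this is how the constants come to depend on `δ₀`. -/
lemma log_div_le_mul_log {δ δ₀ : ℝ} (hδ : 0 < δ) (hδδ₀ : δ ≤ δ₀) (hδ₀ : δ₀ < 1) :
    Real.log (2.5 / δ) ≤ (1 + Real.log 2.5 / Real.log (1 / δ₀)) * Real.log (1 / δ) := by
  have hδ₀' : 0 < δ₀ := hδ.trans_le hδδ₀
  have hL0 : 0 < Real.log (1 / δ₀) := Real.log_pos ((one_lt_div hδ₀').2 hδ₀)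
  have hL : Real.log (1 / δ₀) ≤ Real.log (1 / δ) :=
    Real.log_le_log (by positivity) (one_div_le_one_div_of_le hδ hδδ₀)
  have h25 : 0 ≤ Real.log 2.5 := Real.log_nonneg (by norm_num)
  have e : Real.log (2.5 / δ) = Real.log 2.5 + Real.log (1 / δ) := by
    rw [← Real.log_mul (by norm_num) (by positivity)]
    congr 1; ring
  have h1 : Real.log 2.5 ≤ Real.log 2.5 / Real.log (1 / δ₀) * Real.log (1 / δ) := by
    rw [div_mul_eq_mul_div, le_div_iff₀ hL0]
    gcongr
  rw [e]; linarith

/-- The failure probability of the estimator, in terms of the rate `s` of the theorem, under lower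
bounds on the sample size. -/
lemma estimate_of_rate {d n k : ℕ} {P : Measure (EuclideanSpace ℝ (Fin d) × ℝ)}
    [IsProbabilityMeasure P] {θ : EuclideanSpace ℝ (Fin d)} {σ : ℝ≥0} {κ κx ε δ K s τ r lam : ℝ}
    (hd : 1 ≤ d) (hn : 2 ≤ n) (hσ : 0 < σ) (hκ : 0 < κ) (hε : 0 < ε) (hδ : 0 < δ) (hδ1 : δ < 1)
    (hM : IsSparseLinearModel P θ k) (hC : CovarianceAssumption P θ κ κx)
    (hG : SubGaussianAssumption P σ)
    (hK : Real.log (2.5 / δ) ≤ K * Real.log (1 / δ))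
    (hs : 0 < s)
    (hs2 : n * s ^ 2 = d ^ 2 * Real.log n ^ 2 * (Real.log d * Real.log (1 / δ)) / ε ^ 2)
    (hds : d * (64 * √K * σ ^ 2 * s) ≤ κ / 4)
    (hτ : τ = 2 * (σ * √(Real.log n))) (hr : r = 2 * (σ * √(d * Real.log n)))
    (hlam : lam = 2 * σ ^ 2 * (1 + 128 * √K) / κ * s) :
    1 - (4 * d / n + d ^ 2 * (816 * σ ^ 4 / n) / (κ ^ 2 / (16 * d))
        + d * (816 * σ ^ 4 / n) / (σ ^ 2 * s) ^ 2 + 4 / d) ≤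
      (experiment n P r τ τ ε δ).real
        {ω | IsUnit (serverCov (reports r τ τ ω)).det ∧
          ‖serverEstimate lam (reports r τ τ ω) - θ‖ ≤ 2 * lam * √k} := by
  have hn' : (0 : ℝ) < n := by positivity
  have hd' : (1 : ℝ) ≤ d := by exact_mod_cast hd
  have hσ' : (0 : ℝ) < σ := hσ
  have hlogn : 0 < Real.log n := by linarith [half_le_log_natCast hn]
  have hlogδ : 0 < Real.log (1 / δ) := Real.log_pos ((one_lt_div hδ).2 hδ1)
  have hlogδ2 : 0 < Real.log (2.5 / δ) := Real.log_pos ((one_lt_div hδ).2 (by linarith))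
  have hK0 : 0 < K := by
    by_contra hneg
    nlinarith
  have hτ0 : 0 < τ := by rw [hτ]; positivity
  have hτ2 : τ ^ 2 = 4 * σ ^ 2 * Real.log n := by
    rw [hτ, mul_pow, mul_pow, Real.sq_sqrt hlogn.le]; ring
  -- With this relation, unclipped coordinates force `‖x‖ ≤ r`, so the `ℓ₂` clipping needs no bad
  -- event of its own.
  have hrτ : r = √d * τ := by
    rw [hr, hτ, Real.sqrt_mul (by positivity)]; ring
  have hr0 : 0 < r := by rw [hrτ]; positivity
  have hr4 : r ^ 4 = 16 * σ ^ 4 * d ^ 2 * Real.log n ^ 2 := by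
    have h2 : r ^ 2 = 4 * σ ^ 2 * (d * Real.log n) := by
      rw [hrτ, mul_pow, Real.sq_sqrt (by positivity), hτ2]; ring
    calc r ^ 4 = (r ^ 2) ^ 2 := by ring
      _ = _ := by rw [h2]; ring
  -- One variance bound for both noises, with `512 = 32 * 16`: the vector variance is smaller than
  -- the matrix variance by a factor `d`.
  set V : ℝ := 512 * σ ^ 4 * d ^ 2 * Real.log n ^ 2 * (K * Real.log (1 / δ)) / ε ^ 2 with hV
  have hv₁V : 32 * r ^ 4 * Real.log (2.5 / δ) / ε ^ 2 ≤ V := by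
    rw [hr4, hV]
    refine div_le_div_of_nonneg_right ?_ (by positivity)
    calc _ = 512 * σ ^ 4 * d ^ 2 * Real.log n ^ 2 * Real.log (2.5 / δ) := by ring
      _ ≤ _ := mul_le_mul_of_nonneg_left hK (by positivity)
  have hv₂V : 32 * d * τ ^ 2 * τ ^ 2 * Real.log (2.5 / δ) / ε ^ 2 ≤ V := by
    rw [hτ2, hV]
    refine div_le_div_of_nonneg_right ?_ (by positivity)
    calc _ = 512 * σ ^ 4 * (d : ℝ) * Real.log n ^ 2 * Real.log (2.5 / δ) := by ring
      _ ≤ 512 * σ ^ 4 * d ^ 2 * Real.log n ^ 2 * Real.log (2.5 / δ) := by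
        gcongr
        exact le_self_pow₀ hd' two_ne_zero
      _ ≤ _ := mul_le_mul_of_nonneg_left hK (by positivity)
  -- `64² = 8 * 512`, so that `n T² = 8 log d · V` holds exactly.
  set T : ℝ := 64 * √K * σ ^ 2 * s with hTdef
  have hT0 : 0 ≤ T := by positivity
  have hTV : n * T ^ 2 = 8 * Real.log d * V := by
    calc n * T ^ 2 = 4096 * √K ^ 2 * σ ^ 4 * (n * s ^ 2) := by rw [hTdef]; ring
      _ = 8 * Real.log d * V := by rw [Real.sq_sqrt hK0.le, hs2, hV]; ring
  have hlam0 : 0 ≤ lam := by rw [hlam]; positivity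
  have hB1 := measureReal_clip_le hd hn hσ hG hτ
  -- The threshold is `(κ / 4)² / d`, what Cauchy–Schwarz needs for row sums at most `κ / 4`.
  have hB2 := measureReal_sampleCov_le hn hσ hG hM.integrable_x
    (t := κ ^ 2 / (16 * d)) (by positivity)
  have hB3 := measureReal_residual_le hn hσ hG hM hC.l1_le_one
    (t := (σ ^ 2 * s) ^ 2) (by positivity)
  have hB4 := measureReal_noise_le (r := r) (τ := τ) (ε := ε) (δ := δ) hd hn
    (by positivity) hv₁V (by positivity) hv₂V hT0 hTV
  set A1 := {ω : Fin n → EuclideanSpace ℝ (Fin d) × ℝ | ∃ j : Fin d, ∃ i, τ ≤ |(ω i).1 j|} ∪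
    {ω | ∃ i, τ ≤ |(ω i).2|} with hA1
  set A2 := {ω : Fin n → EuclideanSpace ℝ (Fin d) × ℝ | κ ^ 2 / (16 * d) ≤ ∑ p : Fin d × Fin d,
    ((n : ℝ)⁻¹ * ∑ i, (ω i).1 p.1 * (ω i).1 p.2 - covMat P p.1 p.2) ^ 2} with hA2
  set A3 := {ω : Fin n → EuclideanSpace ℝ (Fin d) × ℝ | (σ ^ 2 * s) ^ 2 ≤
    ∑ j, ((n : ℝ)⁻¹ * ∑ i, (ω i).1 j * ((ω i).2 - ⟪θ, (ω i).1⟫)) ^ 2} with hA3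
  set B := {ω : Fin n → Noise d |
      ∃ p : Fin d × Fin d, T ≤ |(n : ℝ)⁻¹ * ∑ i, (ω i).1 p.1 p.2|} ∪
    {ω | ∃ j : Fin d, T ≤ |(n : ℝ)⁻¹ * ∑ i, (ω i).2 j|} with hB
  refine le_trans ?_ (one_sub_le_measureReal_prod (A := A1 ∪ A2 ∪ A3) (B := B) ?_)
  · have h1 := measureReal_union_le (μ := Measure.pi fun _ : Fin n => P) (A1 ∪ A2) A3
    have h2 := measureReal_union_le (μ := Measure.pi fun _ : Fin n => P) A1 A2
    linarith
  · intro ω hA hBn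
    simp only [hA1, hA2, hA3, hB, Set.mem_union, Set.mem_ofPred_eq, not_or, not_exists,
      not_le] at hA hBn
    obtain ⟨⟨⟨hx, hy⟩, hE⟩, hg⟩ := hA
    refine estimate_of_no_clipping (T := T) (g := σ ^ 2 * s) hκ hC.lower_inf hC.l1_le_one
      hM.sparse (fun i => ?_) (fun i j => (hx j i).le) (fun i => (hy i).le) ?_ (fun j => ?_)
      (fun j l => (hBn.1 (j, l)).le) (fun j => (hBn.2 j).le) hT0 hds hlam0 ?_
    · rw [hrτ]
      exact norm_le_sqrt_card_mul hτ0.le fun j => (hx j i).le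
    · rw [lt_div_iff₀ (by positivity)] at hE
      linarith
    · refine abs_le_of_sq_le_sq (le_trans ?_ hg.le) (by positivity)
      exact Finset.single_le_sum (f := fun j =>
        ((n : ℝ)⁻¹ * ∑ i, (ω.1 i).1 j * ((ω.1 i).2 - ⟪θ, (ω.1 i).1⟫)) ^ 2)
        (fun j _ => sq_nonneg _) (Finset.mem_univ j)
    -- `lam` is chosen to make `g + 2 T = (κ / 2) lam` an equality.
    · rw [hlam, hTdef]
      refine le_of_eq ?_
      field_simp
      ring

/-- The failure probability in `estimate_of_rate` is of order `1 / d`. -/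
lemma failure_probability_le {d n σ κ L s : ℝ} (hd : 1 ≤ d) (hn : 0 < n) (hσ : 0 < σ) (hκ : 0 < κ)
    (hL : 0 < L) {C : ℝ} (hC : 0 < C) (hs : 0 < s) (hsize : C * L * d ^ 4 ≤ 8 * (n * κ))
    (hrate : d ^ 2 * L ≤ 8 * (n * s ^ 2)) :
    4 * d / n + d ^ 2 * (816 * σ ^ 4 / n) / (κ ^ 2 / (16 * d))
        + d * (816 * σ ^ 4 / n) / (σ ^ 2 * s) ^ 2 + 4 / d ≤
      (32 * κ / (C * L) + 104448 * σ ^ 4 / (κ * (C * L)) + 6528 / L + 4) / d := by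
  have hd0 : 0 < d := by linarith
  have h1 : 4 * d / n ≤ 32 * κ / (C * L) / d := by
    rw [div_div, div_le_div_iff₀ hn (by positivity)]
    have : d ^ 2 ≤ d ^ 4 := pow_le_pow_right₀ hd (by norm_num)
    nlinarith [mul_le_mul_of_nonneg_left this (by positivity : 0 ≤ C * L)]
  -- This term is of order `d³ / n` and uses the full `d⁴` in the sample size; `104448 = 816 * 16 *
  -- 8`.
  have h2 : d ^ 2 * (816 * σ ^ 4 / n) / (κ ^ 2 / (16 * d)) ≤
      104448 * σ ^ 4 / (κ * (C * L)) / d := by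
    have e : d ^ 2 * (816 * σ ^ 4 / n) / (κ ^ 2 / (16 * d)) =
        13056 * σ ^ 4 * d ^ 3 / (n * κ ^ 2) := by
      field_simp; ring
    rw [e, div_div, div_le_div_iff₀ (by positivity) (by positivity)]
    have := mul_le_mul_of_nonneg_left hsize (by positivity : 0 ≤ 13056 * σ ^ 4 * κ)
    linarith
  have h3 : d * (816 * σ ^ 4 / n) / (σ ^ 2 * s) ^ 2 ≤ 6528 / L / d := by
    have e : d * (816 * σ ^ 4 / n) / (σ ^ 2 * s) ^ 2 = 816 * d / (n * s ^ 2) := by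
      field_simp
    rw [e, div_div, div_le_div_iff₀ (by positivity) (by positivity)]
    linarith
  calc _ ≤ 32 * κ / (C * L) / d + 104448 * σ ^ 4 / (κ * (C * L)) / d + 6528 / L / d + 4 / d := by
        linarith
    _ = _ := by ring

end SparseLDP

/-! ### Choice of constants and conclusion -/

theorem mainTheorem2 :
    ∃ aτ ar c c' : ℝ, 0 < aτ ∧ 0 < ar ∧ 0 < c ∧ 0 < c' ∧
    ∀ (σ : ℝ≥0) (κinf κx δ₀ : ℝ), 0 < σ → 0 < κinf → 0 < κx → 0 < δ₀ → δ₀ < 1 →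
    ∃ aLam Cn Cerr Cprob : ℝ, 0 < aLam ∧ 0 < Cn ∧ 0 < Cerr ∧ 0 < Cprob ∧
    ∀ (d n k : ℕ) (ε δ : ℝ) (θ : EuclideanSpace ℝ (Fin d))
      (P : Measure (EuclideanSpace ℝ (Fin d) × ℝ)) [IsProbabilityMeasure P],
      1 ≤ d → 2 ≤ n → 0 < ε → ε < 1 → 0 < δ → δ ≤ δ₀ →
      SparseLDP.IsSparseLinearModel P θ k →
      SparseLDP.CovarianceAssumption P θ κinf κx →
      SparseLDP.SubGaussianAssumption P σ →
      Cn * Real.log n ^ 2 * Real.log d * Real.log (1 / δ) *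
          max ((d : ℝ) ^ 4 / (ε ^ 2 * κinf))
            (SparseLDP.specNorm (SparseLDP.covMat P) ^ 4 * (d : ℝ) ^ 3 /
              (ε ^ 2 * SparseLDP.lambdaMin (SparseLDP.covMat P) ^ 2)) ≤ n →
      ∀ τ r lam : ℝ,
        τ = aτ * (σ * √(Real.log n)) →
        r = ar * (σ * √(d * Real.log n)) →
        lam = aLam * (d * Real.log n * √(Real.log d * Real.log (1 / δ)) / (√n * ε)) →
        1 - Cprob * (d : ℝ) ^ (-c) - Real.exp (-c' * d) ≤
          (SparseLDP.experiment n P r τ τ ε δ).real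
            {ω | IsUnit (SparseLDP.serverCov (SparseLDP.reports r τ τ ω)).det ∧
              ‖SparseLDP.serverEstimate lam (SparseLDP.reports r τ τ ω) - θ‖ ≤
                Cerr * (d * Real.log n * √(k * Real.log d * Real.log (1 / δ)) / (√n * ε))} := by
  refine ⟨2, 2, 1, 1, by norm_num, by norm_num, one_pos, one_pos, ?_⟩
  intro σ κ κx δ₀ hσ hκ _ hδ₀ hδ₀1
  have hσ' : (0 : ℝ) < σ := hσ
  set L₀ := Real.log (1 / δ₀) with hL₀
  have hL₀pos : 0 < L₀ := Real.log_pos ((one_lt_div hδ₀).2 hδ₀1)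
  set K : ℝ := 1 + Real.log 2.5 / L₀ with hKdef
  have hKpos : 0 < K := by
    have : 0 ≤ Real.log 2.5 := Real.log_nonneg (by norm_num)
    positivity
  set aLam : ℝ := 2 * σ ^ 2 * (1 + 128 * √K) / κ with haLam
  have haLam0 : 0 < aLam := by positivity
  -- `65536 = 64² * 16`: the value for which the sample-size condition yields `d T ≤ κ / 4`.
  set Cn : ℝ := 65536 * K * σ ^ 4 / κ with hCn
  have hCn0 : 0 < Cn := by positivity
  set Cp : ℝ := 32 * κ / (Cn * L₀) + 104448 * σ ^ 4 / (κ * (Cn * L₀)) + 6528 / L₀ + 4 with hCp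
  have hCp4 : 4 ≤ Cp := le_add_of_nonneg_left (by positivity)
  refine ⟨aLam, Cn, 2 * aLam, Cp, haLam0, hCn0, by positivity, by linarith, ?_⟩
  intro d n k ε δ θ P _ hd hn hε hε1 hδ hδδ₀ hM hC hG hsize τ r lam hτ hr hlam
  have hd' : (1 : ℝ) ≤ d := by exact_mod_cast hd
  have hn' : (0 : ℝ) < n := by positivity
  rw [Real.rpow_neg_one, ← div_eq_mul_inv]
  -- For `d = 1`, `log d = 0` makes the rate vanish and the sample-size condition empty, but `Cp ≥
  -- 4` makes the claimed probability bound negative.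
  rcases hd.eq_or_lt with rfl | hd2
  · refine le_trans ?_ measureReal_nonneg
    have := Real.exp_pos (-1 * ((1 : ℕ) : ℝ))
    simp only [Nat.cast_one, div_one] at this ⊢
    linarith
  have hN := SparseLDP.half_le_log_natCast hn
  have hl := SparseLDP.half_le_log_natCast hd2
  have hL : L₀ ≤ Real.log (1 / δ) :=
    Real.log_le_log (by positivity) (one_div_le_one_div_of_le hδ hδδ₀)
  have hLpos : 0 < Real.log (1 / δ) := hL₀pos.trans_le hL
  have hKL := SparseLDP.log_div_le_mul_log hδ hδδ₀ hδ₀1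
  generalize hNdef : Real.log n = N at *
  generalize hldef : Real.log d = l at *
  generalize hLdef : Real.log (1 / δ) = L at *
  have hNpos : 0 < N := by linarith
  have hlpos : 0 < l := by linarith
  set s : ℝ := d * N * √(l * L) / (√n * ε) with hs
  have hspos : 0 < s := by positivity
  have hs2 : n * s ^ 2 = d ^ 2 * N ^ 2 * (l * L) / ε ^ 2 := by
    rw [hs, div_pow, mul_pow, mul_pow, mul_pow, Real.sq_sqrt (by positivity),
      Real.sq_sqrt hn'.le]
    field_simp
  -- All three logarithms are bounded below, since `n, d ≥ 2` and `δ ≤ δ₀`, so the logarithmic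
  -- factors can be discarded in the failure probability.
  have hprod : L₀ ≤ 8 * (N ^ 2 * l * L) := by
    have h1 : (1 / 2) ^ 2 * (1 / 2) * L₀ ≤ N ^ 2 * l * L := by gcongr
    linarith
  have hsize' : Cn * (N ^ 2 * l * L) * d ^ 4 ≤ n * ε ^ 2 * κ := by
    have h := (mul_le_mul_of_nonneg_left (le_max_left _ _) (by positivity)).trans hsize
    rw [mul_div_assoc', div_le_iff₀ (by positivity)] at h
    linarith
  have hε2 : ε ^ 2 ≤ 1 := pow_le_one₀ hε.le hε1.le
  have hds : d * (64 * √K * σ ^ 2 * s) ≤ κ / 4 := by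
    refine abs_le_of_sq_le_sq' ?_ (by positivity) |>.2
    have e : (d * (64 * √K * σ ^ 2 * s)) ^ 2 * (n * ε ^ 2 * 16)
        = κ * (Cn * (N ^ 2 * l * L) * d ^ 4) := by
      have h2 : n * s ^ 2 * ε ^ 2 = d ^ 2 * N ^ 2 * (l * L) := by
        rw [hs2]; field_simp
      calc _ = 65536 * d ^ 2 * √K ^ 2 * σ ^ 4 * (n * s ^ 2 * ε ^ 2) := by ring
        _ = _ := by rw [h2, Real.sq_sqrt hKpos.le, hCn]; field_simp
    have h3 : (d * (64 * √K * σ ^ 2 * s)) ^ 2 * (n * ε ^ 2 * 16)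
        ≤ (κ / 4) ^ 2 * (n * ε ^ 2 * 16) := by
      rw [e]
      calc _ ≤ κ * (n * ε ^ 2 * κ) := mul_le_mul_of_nonneg_left hsize' hκ.le
        _ = _ := by ring
    exact le_of_mul_le_mul_right h3 (by positivity)
  have key := SparseLDP.estimate_of_rate hd hn hσ hκ hε hδ (hδδ₀.trans_lt hδ₀1) hM hC hG
    (K := K) (s := s) (τ := τ) (r := r) (by rw [hLdef]; exact hKL) hspos
    (by rw [hNdef, hldef, hLdef]; exact hs2) hds
    (by rw [hNdef]; exact hτ) (by rw [hNdef]; exact hr) hlam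
  have hfail := SparseLDP.failure_probability_le (σ := σ) hd' hn' hσ' hκ hL₀pos hCn0 hspos
    (by
      calc Cn * L₀ * d ^ 4 ≤ Cn * (8 * (N ^ 2 * l * L)) * d ^ 4 := by gcongr
        _ = 8 * (Cn * (N ^ 2 * l * L) * d ^ 4) := by ring
        _ ≤ 8 * (n * ε ^ 2 * κ) := by gcongr
        _ ≤ 8 * (n * 1 * κ) := by gcongr
        _ = 8 * (n * κ) := by ring)
    (by
      rw [hs2, mul_div_assoc', le_div_iff₀ (by positivity)]
      calc (d : ℝ) ^ 2 * L₀ * ε ^ 2 ≤ d ^ 2 * (8 * (N ^ 2 * l * L)) * 1 := by gcongr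
        _ = 8 * (d ^ 2 * N ^ 2 * (l * L)) := by ring)
  have herr : 2 * lam * √k = 2 * aLam * (d * N * √(k * l * L) / (√n * ε)) := by
    rw [hlam, hs, mul_assoc (k : ℝ), Real.sqrt_mul (Nat.cast_nonneg k)]
    ring
  rw [herr] at key
  linarith [Real.exp_pos (-1 * (d : ℝ))]
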